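/- **Theorem 4.3 (Criterion for hFC measures).** Let $n\in\mathbb N$. For $z,w\in\mathbb C^n$ write $z\cdot\overline w=\sum_k z_k\overline{w_k}$ and $|z|^2=z\cdot\overline z$, and let $\nu_n$, $\nu_{2n}$ be the Lebesgue measures on $\mathbb R^n$ and on $\mathbb C^n\simeq\mathbb R^{2n}$. Let $\mathcal F^2(\mathbb C^n)$ be the Fock space, i.e. the space of all entire functions on $\mathbb C^n$ that are square integrable with respect to $d\gamma_n(z)=\pi^{-n}e^{-|z|^2}d\nu_{2n}(z)$, with the norm and inner product of $L_2(\mathbb C^n,d\gamma_n)$. For $h\in\mathbb C^n$ let $W_h$ be the Weyl operator $(W_hf)(z)=e^{z\cdot\overline h-|h|^2/2}f(z-h)$, a unitary operator on $\mathcal F^2(\mathbb C^n)$. Let $\mu$ be a positive Fock–Carleson measure on $\mathbb C^n$, i.e. a positive Borel measure for which there is a constant $\omega>0$ with $$\int_{\mathbb C^n}|f(w)|^2e^{-|w|^2}\,d\mu(w)\le\omega\,\|f\|^2\qquad\text{for all } f\in\mathcal F^2(\mathbb C^n).$$ Then the Toeplitz operator $$(T_\mu f)(z)=\pi^{-n}\int_{\mathbb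 C^n}e^{z\cdot\overline w}f(w)e^{-|w|^2}\,d\mu(w),\qquad f\in\mathcal F^2(\mathbb C^n),\ z\in\mathbb C^n,$$ is well defined (the integral converges absolutely) and is a bounded operator on $\mathcal F^2(\mathbb C^n)$, and the following conditions are equivalent: 1. $T_\mu$ is horizontal, i.e. $W_{ih}T_\mu=T_\mu W_{ih}$ for every $h\in\mathbb R^n$. 2. The Berezin transform $\widetilde\mu(z)=\pi^{-n}\int_{\mathbb C^n}e^{-|z-w|^2}\,d\mu(w)$ depends only on $\operatorname{Re}z$, i.e. there is a function $b:\mathbb R^n\to\mathbb R$ with $\widetilde\mu(z)=b(\operatorname{Re}z)$ for all $z\in\mathbb C^n$. 3. $\mu(X+ih)=\mu(X)$ for every Borel set $X\subset\mathbb C^n$ and every $h\in\mathbb R^n$. 4. $\mu(Y\times(Z+h))=\mu(Y\times Z)$ for all Borel sets $Y,Z\subset\mathbb R^n$ and every $h\in\mathbb R^n$, where $\mathbb C^n$ is identified with $\mathbb R^n\times\mathbb R^n$ by $z\mapsto(\operatorname{Re}z,\operatorname{Im}z)$. 5. There is a positive regular Borel measure $\varrho$ on $\mathbb R^n$, finite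 on compact sets, with $\mu=\varrho\otimes\nu_n$ under the same identification. -/

import Mathlib

open MeasureTheory
open scoped ENNReal

namespace FockCarleson

noncomputable section

/-- `|z|² = ∑ |z_k|²`; the Euclidean one, since the norm of `Fin n → ℂ` is the sup norm. -/
def sqNorm {n : ℕ} (z : Fin n → ℂ) : ℝ := ∑ k, ‖z k‖ ^ 2

/-- `z · conj w = ∑ z_k conj (w_k)`. -/
def herm {n : ℕ} (z w : Fin n → ℂ) : ℂ := ∑ k, z k * (starRingEnd ℂ) (w k)

/-- `Re z ∈ ℝⁿ`. -/
def rePart {n : ℕ} (z : Fin n → ℂ) : Fin n → ℝ := fun k => (z k).re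

/-- `Im z ∈ ℝⁿ`. -/
def imPart {n : ℕ} (z : Fin n → ℂ) : Fin n → ℝ := fun k => (z k).im

/-- `i h ∈ ℂⁿ` for `h ∈ ℝⁿ`. -/
def imag {n : ℕ} (h : Fin n → ℝ) : Fin n → ℂ := fun k => Complex.I * (h k : ℂ)

/-- The identification `ℝⁿ × ℝⁿ → ℂⁿ`, `(x, y) ↦ x + i y`. -/
def ofReIm {n : ℕ} (p : (Fin n → ℝ) × (Fin n → ℝ)) : Fin n → ℂ :=
  fun k => (p.1 k : ℂ) + Complex.I * (p.2 k : ℂ)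

/-- The subset `Y × Z` of `ℂⁿ = ℝⁿ × ℝⁿ`. -/
def reImProd {n : ℕ} (Y Z : Set (Fin n → ℝ)) : Set (Fin n → ℂ) :=
  {z | rePart z ∈ Y ∧ imPart z ∈ Z}

/-- The Gaussian measure `dγ(z) = π⁻ⁿ exp(-|z|²) dν(z)`, `ν` the Lebesgue measure on `ℂⁿ`. -/
def gaussian (n : ℕ) : Measure (Fin n → ℂ) :=
  (volume : Measure (Fin n → ℂ)).withDensity
    fun z => ENNReal.ofReal ((Real.pi ^ n)⁻¹ * Real.exp (-sqNorm z))

/-- The entire functions on `ℂⁿ` that are square integrable for the Gaussian measure. -/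
def fockSubmodule (n : ℕ) : Submodule ℂ ((Fin n → ℂ) → ℂ) where
  carrier := {f | Differentiable ℂ f ∧ MemLp f 2 (gaussian n)}
  add_mem' hf hg := ⟨hf.1.add hg.1, hf.2.add hg.2⟩
  zero_mem' := ⟨differentiable_const 0, MemLp.zero⟩
  smul_mem' c _ hf := ⟨hf.1.const_smul c, hf.2.const_smul c⟩

/-- The Fock space. This is a type of its own, so that it carries the topology of its norm
(defined below) and not the topology of pointwise convergence. -/
def Fock (n : ℕ) : Type := fockSubmodule n

namespace Fock

variable {n : ℕ}

instance : AddCommGroup (Fock n) := inferInstanceAs (AddCommGroup (fockSubmodule n))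

instance : Module ℂ (Fock n) := inferInstanceAs (Module ℂ (fockSubmodule n))

/-- The elements of the Fock space are functions. -/
instance : FunLike (Fock n) (Fin n → ℂ) ℂ where
  coe f := f.1
  coe_injective _ _ h := Subtype.ext h

theorem differentiable (f : Fock n) : Differentiable ℂ f := f.2.1

theorem memLp (f : Fock n) : MemLp f 2 (gaussian n) := f.2.2

theorem continuous_sqNorm : Continuous (sqNorm : (Fin n → ℂ) → ℝ) := by
  unfold sqNorm; fun_prop

theorem volume_absolutelyContinuous :
    (volume : Measure (Fin n → ℂ)) ≪ gaussian n := by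
  refine withDensity_absolutelyContinuous' ?_ ?_
  · have := continuous_sqNorm (n := n)
    exact (by fun_prop : Measurable fun z : Fin n → ℂ =>
      ENNReal.ofReal ((Real.pi ^ n)⁻¹ * Real.exp (-sqNorm z))).aemeasurable
  · refine Filter.Eventually.of_forall fun z => ?_
    have : 0 < (Real.pi ^ n)⁻¹ * Real.exp (-sqNorm z) := by positivity
    simpa using this

/-- The inclusion of the Fock space into `L²(ℂⁿ, dγ)`. -/
def toL2 (n : ℕ) : Fock n →ₗ[ℂ] Lp ℂ 2 (gaussian n) where
  toFun f := (memLp f).toLp f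
  map_add' _ _ := rfl
  map_smul' _ _ := rfl

theorem toL2_injective : Function.Injective (toL2 n) := by
  intro f g h
  have h1 : (f : (Fin n → ℂ) → ℂ) =ᵐ[gaussian n] g :=
    (MemLp.toLp_eq_toLp_iff (memLp f) (memLp g)).1 h
  have h2 := volume_absolutelyContinuous.ae_eq h1
  exact DFunLike.coe_injective ((Continuous.ae_eq_iff_eq volume (differentiable f).continuous
    (differentiable g).continuous).1 h2)

/-- The norm of the Fock space is the norm of `L²(ℂⁿ, dγ)`. -/
instance : NormedAddCommGroup (Fock n) :=
  NormedAddCommGroup.induced (Fock n) (Lp ℂ 2 (gaussian n)) (toL2 n) toL2_injective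

/-- The inner product of the Fock space is that of `L²(ℂⁿ, dγ)`. -/
instance : InnerProductSpace ℂ (Fock n) where
  norm_smul_le c f := by
    change ‖toL2 n (c • f)‖ ≤ ‖c‖ * ‖toL2 n f‖
    rw [map_smul, norm_smul]
  inner f g := inner ℂ (toL2 n f) (toL2 n g)
  norm_sq_eq_re_inner f := norm_sq_eq_re_inner (𝕜 := ℂ) (toL2 n f)
  conj_inner_symm f g := inner_conj_symm (toL2 n f) (toL2 n g)
  add_left f g h := by
    change inner ℂ (toL2 n (f + g)) (toL2 n h) = _
    rw [map_add, inner_add_left]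
  smul_left f g c := by
    change inner ℂ (toL2 n (c • f)) (toL2 n g) = _
    rw [map_smul, inner_smul_left]

theorem norm_eq (f : Fock n) : ‖f‖ = (eLpNorm f 2 (gaussian n)).toReal :=
  Lp.norm_toLp _ (memLp f)

end Fock

/-- The weighted translation `(W_h f)(z) = exp(z · conj h - |h|²/2) f(z - h)`. -/
def weylFun {n : ℕ} (h : Fin n → ℂ) (f : (Fin n → ℂ) → ℂ) : (Fin n → ℂ) → ℂ :=
  fun z => Complex.exp (herm z h - ((sqNorm h / 2 : ℝ) : ℂ)) * f (z - h)

theorem differentiable_weylFun {n : ℕ} (h : Fin n → ℂ) {f : (Fin n → ℂ) → ℂ}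
    (hf : Differentiable ℂ f) : Differentiable ℂ (weylFun h f) := by
  unfold weylFun herm
  exact Differentiable.mul (by fun_prop) (hf.comp (by fun_prop))

theorem sqNorm_sub {n : ℕ} (z h : Fin n → ℂ) :
    sqNorm (z - h) = sqNorm z - 2 * (herm z h).re + sqNorm h := by
  simp only [sqNorm, herm, Complex.re_sum, Finset.mul_sum, ← Finset.sum_sub_distrib,
    ← Finset.sum_add_distrib, Pi.sub_apply, Complex.sq_norm, Complex.normSq_apply]
  refine Finset.sum_congr rfl fun k _ => ?_
  simp
  ring

theorem eLpNorm_weylFun {n : ℕ} (h : Fin n → ℂ) {f : (Fin n → ℂ) → ℂ} (hf : Continuous f) :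
    eLpNorm (weylFun h f) 2 (gaussian n) = eLpNorm f 2 (gaussian n) := by
  have hs := Fock.continuous_sqNorm (n := n)
  have hd : Measurable fun z : Fin n → ℂ =>
      ENNReal.ofReal ((Real.pi ^ n)⁻¹ * Real.exp (-sqNorm z)) := by fun_prop
  have hw : Continuous (weylFun h f) := by
    unfold weylFun herm
    fun_prop
  rw [eLpNorm_eq_lintegral_rpow_enorm_toReal (by norm_num) (by norm_num),
    eLpNorm_eq_lintegral_rpow_enorm_toReal (by norm_num) (by norm_num)]
  congr 1
  unfold gaussian
  rw [lintegral_withDensity_eq_lintegral_mul _ hd (by fun_prop),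
    lintegral_withDensity_eq_lintegral_mul _ hd (by fun_prop)]
  refine Eq.trans ?_ (lintegral_sub_right_eq_self _ h)
  refine lintegral_congr fun z => ?_
  simp only [Pi.mul_apply, weylFun, ENNReal.toReal_ofNat, ENNReal.rpow_ofNat, enorm_mul, mul_pow]
  rw [← mul_assoc]
  congr 1
  rw [← ofReal_norm (Complex.exp _), ← ENNReal.ofReal_pow (norm_nonneg _),
    ← ENNReal.ofReal_mul (by positivity), Complex.norm_exp, ← Real.exp_nat_mul, mul_assoc,
    ← Real.exp_add, sqNorm_sub]
  congr 3
  simp only [Complex.sub_re, Complex.ofReal_re]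
  push_cast
  ring

/-- The Weyl operator `W_h` on the Fock space. -/
def weyl {n : ℕ} (h : Fin n → ℂ) : Fock n →ₗᵢ[ℂ] Fock n where
  toFun f := ⟨weylFun h f, differentiable_weylFun h f.differentiable,
    (differentiable_weylFun h f.differentiable).continuous.aestronglyMeasurable, by
      rw [eLpNorm_weylFun h f.differentiable.continuous]; exact f.memLp.2⟩
  map_add' f g := DFunLike.ext _ _ fun z => mul_add _ (f (z - h)) (g (z - h))
  map_smul' c f := DFunLike.ext _ _ fun z => mul_left_comm _ c (f (z - h))
  norm_map' f := by
    rw [Fock.norm_eq, Fock.norm_eq]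
    exact congrArg ENNReal.toReal (eLpNorm_weylFun h f.differentiable.continuous)

/-- `μ` is a Fock–Carleson measure: `∫ |f|² exp(-|w|²) dμ ≤ ω ‖f‖²` for all `f` in the Fock
space. The integral takes values in `[0, ∞]`. -/
def IsFockCarleson {n : ℕ} (μ : Measure (Fin n → ℂ)) : Prop :=
  ∃ ω : ℝ, 0 < ω ∧ ∀ f : Fock n,
    ∫⁻ w, ENNReal.ofReal (‖f w‖ ^ 2 * Real.exp (-sqNorm w)) ∂μ ≤ ENNReal.ofReal (ω * ‖f‖ ^ 2)

/-- The integrand `exp(z · conj w) f(w) exp(-|w|²)`. -/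
def toeplitzIntegrand {n : ℕ} (f : (Fin n → ℂ) → ℂ) (z w : Fin n → ℂ) : ℂ :=
  Complex.exp (herm z w) * f w * (Real.exp (-sqNorm w) : ℂ)

/-- `T` is the Toeplitz operator `T_μ`, that is, for every `f` in the Fock space and every `z`,
`(T f)(z) = π⁻ⁿ ∫ exp(z · conj w) f(w) exp(-|w|²) dμ(w)`, an absolutely convergent integral. -/
def IsToeplitz {n : ℕ} (μ : Measure (Fin n → ℂ)) (T : Fock n →L[ℂ] Fock n) : Prop :=
  ∀ (f : Fock n) (z : Fin n → ℂ), Integrable (toeplitzIntegrand f z) μ ∧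
    T f z = ((Real.pi : ℂ) ^ n)⁻¹ * ∫ w, toeplitzIntegrand f z w ∂μ

/-- A bounded operator on the Fock space is horizontal if it commutes with all `W_{ih}`. -/
def IsHorizontalOp {n : ℕ} (S : Fock n →L[ℂ] Fock n) : Prop :=
  ∀ h : Fin n → ℝ, (weyl (imag h)).toContinuousLinearMap ∘L S =
    S ∘L (weyl (imag h)).toContinuousLinearMap

/-- The Berezin transform `π⁻ⁿ ∫ exp(-|z - w|²) dμ(w)` of a positive measure. -/
def berezin {n : ℕ} (μ : Measure (Fin n → ℂ)) (z : Fin n → ℂ) : ℝ :=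
  (Real.pi ^ n)⁻¹ * ∫ w, Real.exp (-sqNorm (z - w)) ∂μ

/-- `μ = ϱ ⊗ ν`, with `ν` the Lebesgue measure on `ℝⁿ`, for a regular Borel measure `ϱ` on `ℝⁿ`.
(`Measure.Regular` contains finiteness on compact sets.) -/
def IsHorizontalMeasure {n : ℕ} (μ : Measure (Fin n → ℂ)) : Prop :=
  ∃ ϱ : Measure (Fin n → ℝ), ϱ.Regular ∧
    μ = (ϱ.prod (volume : Measure (Fin n → ℝ))).map ofReIm

end

end FockCarleson

namespace FockCarleson

variable {n : ℕ}

theorem measurable_sqNorm : Measurable (sqNorm : (Fin n → ℂ) → ℝ) :=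
  Fock.continuous_sqNorm.measurable

theorem exp_neg_mul_sqNorm (c : ℝ) (z : Fin n → ℂ) :
    Real.exp (-c * sqNorm z) = ∏ k, Real.exp (-c * ‖z k‖ ^ 2) := by
  rw [← Real.exp_sum, sqNorm, Finset.mul_sum]

theorem integral_exp_neg_mul_sqNorm {c : ℝ} (hc : 0 < c) :
    ∫ z : Fin n → ℂ, Real.exp (-c * sqNorm z) = (Real.pi / c) ^ n := by
  simp_rw [exp_neg_mul_sqNorm]
  rw [integral_fintype_prod_volume_eq_pow (fun z : ℂ => Real.exp (-c * ‖z‖ ^ 2)),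
    GaussianFourier.integral_rexp_neg_mul_sq_norm hc]
  simp

theorem integrable_exp_neg_mul_sqNorm {c : ℝ} (hc : 0 < c) :
    Integrable (fun z : Fin n → ℂ => Real.exp (-c * sqNorm z)) := by
  refine not_imp_comm.1 integral_undef ?_
  rw [integral_exp_neg_mul_sqNorm hc]
  have := Real.pi_pos
  positivity

theorem measurable_gaussianDensity : Measurable fun z : Fin n → ℂ =>
    ENNReal.ofReal ((Real.pi ^ n)⁻¹ * Real.exp (-sqNorm z)) := by
  have := measurable_sqNorm (n := n)
  fun_prop

theorem lintegral_gaussian (g : (Fin n → ℂ) → ℝ≥0∞) (hg : Measurable g) :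
    ∫⁻ z, g z ∂gaussian n =
      ∫⁻ z, ENNReal.ofReal ((Real.pi ^ n)⁻¹ * Real.exp (-sqNorm z)) * g z := by
  rw [gaussian, lintegral_withDensity_eq_lintegral_mul _ measurable_gaussianDensity hg]
  rfl

theorem integrable_gaussian_iff {g : (Fin n → ℂ) → ℝ} :
    Integrable g (gaussian n) ↔
      Integrable fun z => (Real.pi ^ n)⁻¹ * Real.exp (-sqNorm z) * g z := by
  rw [gaussian, integrable_withDensity_iff_integrable_smul' measurable_gaussianDensity
    (Filter.Eventually.of_forall fun _ => ENNReal.ofReal_lt_top)]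
  refine integrable_congr (Filter.Eventually.of_forall fun z => ?_)
  simp only [smul_eq_mul]
  rw [ENNReal.toReal_ofReal (by positivity)]

instance isProbabilityMeasure_gaussian : IsProbabilityMeasure (gaussian n) := by
  constructor
  have h := lintegral_gaussian (n := n) (fun _ => 1) measurable_const
  simp only [lintegral_one, mul_one] at h
  have hi := integrable_exp_neg_mul_sqNorm (n := n) one_pos
  simp only [neg_mul, one_mul] at hi
  rw [h, ← ofReal_integral_eq_lintegral_ofReal (hi.const_mul _)
    (Filter.Eventually.of_forall fun _ => by positivity), integral_const_mul]
  have h2 := integral_exp_neg_mul_sqNorm (n := n) one_pos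
  simp only [neg_mul, one_mul, div_one] at h2
  rw [h2, inv_mul_cancel₀ (by positivity), ENNReal.ofReal_one]

theorem sqNorm_smul (u : ℂ) (z : Fin n → ℂ) : sqNorm (u • z) = ‖u‖ ^ 2 * sqNorm z := by
  simp [sqNorm, mul_pow, Finset.mul_sum]

theorem measurePreserving_circle_smul (u : Circle) :
    MeasurePreserving (fun z : Fin n → ℂ => (u : ℂ) • z) (gaussian n) (gaussian n) := by
  have hv : MeasurePreserving (fun z : Fin n → ℂ => (u : ℂ) • z) volume volume :=
    volume_preserving_pi (fun _ : Fin n => (rotation u).measurePreserving)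
  refine ⟨hv.measurable, Measure.ext fun s hs => ?_⟩
  rw [Measure.map_apply hv.measurable hs, gaussian, withDensity_apply _ (hv.measurable hs),
    withDensity_apply _ hs, ← hv.setLIntegral_comp_preimage hs measurable_gaussianDensity]
  have hu : ‖(u : ℂ)‖ = 1 := Circle.norm_coe u
  simp only [sqNorm_smul, hu, one_pow, one_mul]

theorem integral_gaussian_of_differentiable {f : (Fin n → ℂ) → ℂ} (hf : Differentiable ℂ f)
    (hi : Integrable f (gaussian n)) : ∫ z, f z ∂gaussian n = f 0 := by
  have hrot (θ : ℝ) := measurePreserving_circle_smul (n := n) (Circle.exp θ)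
  have hmean (z : Fin n → ℂ) :
      ∫ θ in (0 : ℝ)..2 * Real.pi, f ((Circle.exp θ : ℂ) • z) = (2 * Real.pi) • f 0 := by
    have hd : Differentiable ℂ fun ζ : ℂ => f (ζ • z) := hf.comp (by fun_prop)
    have h := (hd.diffContOnCl (s := Metric.ball (0 : ℂ) |1|)).circleAverage
    rw [Real.circleAverage_def, inv_smul_eq_iff₀ (by positivity)] at h
    simpa [circleMap] using h
  have hpos : (0 : ℝ) ≤ 2 * Real.pi := by positivity
  have hcont : Continuous fun p : ℝ × (Fin n → ℂ) => f ((Circle.exp p.1 : ℂ) • p.2) :=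
    hf.continuous.comp (by fun_prop)
  have hemb (θ : ℝ) : ∫ z, f ((Circle.exp θ : ℂ) • z) ∂gaussian n = ∫ z, f z ∂gaussian n := by
    conv_rhs => rw [← (hrot θ).map_eq]
    rw [integral_map (hrot θ).measurable.aemeasurable hf.continuous.aestronglyMeasurable]
  have hembn (θ : ℝ) :
      ∫ z, ‖f ((Circle.exp θ : ℂ) • z)‖ ∂gaussian n = ∫ z, ‖f z‖ ∂gaussian n := by
    conv_rhs => rw [← (hrot θ).map_eq]
    rw [integral_map (hrot θ).measurable.aemeasurable hf.continuous.norm.aestronglyMeasurable]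
  have hint : Integrable (fun p : ℝ × (Fin n → ℂ) => f ((Circle.exp p.1 : ℂ) • p.2))
      ((volume.restrict (Set.Ioc 0 (2 * Real.pi))).prod (gaussian n)) := by
    rw [integrable_prod_iff hcont.aestronglyMeasurable]
    refine ⟨Filter.Eventually.of_forall fun θ => (hrot θ).integrable_comp_of_integrable hi, ?_⟩
    simp_rw [hembn]
    exact integrable_const _
  have h := integral_integral_swap (f := fun θ z => f ((Circle.exp θ : ℂ) • z)) hint
  simp_rw [hemb, ← intervalIntegral.integral_of_le hpos, hmean] at h
  simp only [intervalIntegral.integral_const, sub_zero, integral_const, probReal_univ,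
    one_smul] at h
  exact smul_right_injective ℂ (by positivity : (2 * Real.pi) ≠ 0) h

/-! ### The reproducing kernel -/

namespace Fock

theorem integrable (f : Fock n) : Integrable f (gaussian n) :=
  f.memLp.integrable (by norm_num)

/-- The constant function `1`. -/
noncomputable def one (n : ℕ) : Fock n :=
  ⟨fun _ => 1, differentiable_const 1, memLp_const 1⟩

@[simp] theorem one_apply (z : Fin n → ℂ) : one n z = 1 := rfl

theorem inner_eq_integral (f g : Fock n) :
    inner ℂ f g = ∫ z, g z * (starRingEnd ℂ) (f z) ∂gaussian n := by
  change inner ℂ (toL2 n f) (toL2 n g) = _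
  rw [L2.inner_def]
  refine integral_congr_ae ?_
  filter_upwards [MemLp.coeFn_toLp f.memLp, MemLp.coeFn_toLp g.memLp] with z h1 h2
  change inner ℂ ((MemLp.toLp f f.memLp) z) ((MemLp.toLp g g.memLp) z) = _
  rw [h1, h2, RCLike.inner_apply]

theorem inner_one (f : Fock n) : inner ℂ (one n) f = f 0 := by
  simp [inner_eq_integral, integral_gaussian_of_differentiable f.differentiable f.integrable]

end Fock

theorem weyl_apply (h : Fin n → ℂ) (f : Fock n) (z : Fin n → ℂ) :
    weyl h f z = Complex.exp (herm z h - ((sqNorm h / 2 : ℝ) : ℂ)) * f (z - h) := rfl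

theorem herm_sub_left (z z' w : Fin n → ℂ) : herm (z - z') w = herm z w - herm z' w := by
  simp [herm, sub_mul, Finset.sum_sub_distrib]

theorem herm_add_right (z w w' : Fin n → ℂ) : herm z (w + w') = herm z w + herm z w' := by
  simp [herm, mul_add, Finset.sum_add_distrib]

theorem herm_neg_right (z w : Fin n → ℂ) : herm z (-w) = -herm z w := by
  simp [herm]

theorem herm_self (z : Fin n → ℂ) : herm z z = (sqNorm z : ℂ) := by
  simp [herm, sqNorm, Complex.mul_conj']

theorem conj_herm (z w : Fin n → ℂ) : (starRingEnd ℂ) (herm z w) = herm w z := by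
  simp [herm, mul_comm]

@[simp] theorem herm_zero_left (w : Fin n → ℂ) : herm 0 w = 0 := by simp [herm]

@[simp] theorem sqNorm_neg (z : Fin n → ℂ) : sqNorm (-z) = sqNorm z := by simp [sqNorm]

theorem weyl_weyl_neg (h : Fin n → ℂ) (f : Fock n) : weyl h (weyl (-h) f) = f := by
  refine DFunLike.ext _ _ fun z => ?_
  rw [weyl_apply, weyl_apply, ← mul_assoc, ← Complex.exp_add, herm_neg_right, herm_sub_left,
    herm_self, sqNorm_neg, sub_neg_eq_add, sub_add_cancel]
  conv_rhs => rw [← one_mul (f z), ← Complex.exp_zero]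
  congr 2
  push_cast
  ring

/-- The normalized reproducing kernel `k_h(z) = exp(z · conj h - |h|²/2)`. -/
noncomputable def coherent (h : Fin n → ℂ) : Fock n := weyl h (Fock.one n)

theorem coherent_apply (h z : Fin n → ℂ) :
    coherent h z = Complex.exp (herm z h - ((sqNorm h / 2 : ℝ) : ℂ)) := by
  simp [coherent, weyl_apply]

theorem inner_coherent (h : Fin n → ℂ) (f : Fock n) :
    inner ℂ (coherent h) f = Complex.exp (-((sqNorm h / 2 : ℝ) : ℂ)) * f h := by
  conv_lhs => rw [← weyl_weyl_neg h f]
  rw [coherent, LinearIsometry.inner_map_map, Fock.inner_one, weyl_apply]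
  simp

/-- The reproducing kernel `K_h(z) = exp(z · conj h)`. -/
noncomputable def kernel (h : Fin n → ℂ) : Fock n :=
  Complex.exp ((sqNorm h / 2 : ℝ) : ℂ) • coherent h

theorem kernel_apply (h z : Fin n → ℂ) : kernel h z = Complex.exp (herm z h) := by
  change Complex.exp _ * coherent h z = _
  rw [coherent_apply, ← Complex.exp_add]
  congr 1
  ring

theorem inner_kernel (h : Fin n → ℂ) (f : Fock n) : inner ℂ (kernel h) f = f h := by
  rw [kernel, inner_smul_left, inner_coherent, ← mul_assoc, ← Complex.exp_conj, Complex.conj_ofReal,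
    ← Complex.exp_add, add_neg_cancel, Complex.exp_zero, one_mul]

end FockCarleson

namespace FockCarleson

variable {n : ℕ}

/-! ### Completeness of the Fock space -/

theorem mul_sum_norm_le {c : ℝ} (w : Fin n → ℂ) :
    c * ∑ k, ‖w k‖ ≤ c ^ 2 * n + sqNorm w / 4 := by
  have : ∀ k, c * ‖w k‖ ≤ c ^ 2 + ‖w k‖ ^ 2 / 4 := fun k => by
    nlinarith [sq_nonneg (c - ‖w k‖ / 2)]
  calc c * ∑ k, ‖w k‖ = ∑ k, c * ‖w k‖ := Finset.mul_sum _ _ _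
    _ ≤ ∑ k, (c ^ 2 + ‖w k‖ ^ 2 / 4) := Finset.sum_le_sum fun k _ => this k
    _ = c ^ 2 * n + sqNorm w / 4 := by
      rw [Finset.sum_add_distrib, sqNorm, Finset.sum_div]
      simp [mul_comm]

theorem memLp_exp_mul_sum_norm (c : ℝ) :
    MemLp (fun w : Fin n → ℂ => Real.exp (c * ∑ k, ‖w k‖)) 2 (gaussian n) := by
  have hm : Measurable fun w : Fin n → ℂ => Real.exp (c * ∑ k, ‖w k‖) := by fun_prop
  rw [memLp_two_iff_integrable_sq hm.aestronglyMeasurable, integrable_gaussian_iff]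
  have hs := measurable_sqNorm (n := n)
  refine ((integrable_exp_neg_mul_sqNorm (n := n) (c := 1 / 2) (by norm_num)).const_mul
    ((Real.pi ^ n)⁻¹ * Real.exp (2 * (c ^ 2 * n)))).mono' (by fun_prop)
    (Filter.Eventually.of_forall fun w => ?_)
  rw [Real.norm_of_nonneg (by positivity), mul_assoc, mul_assoc, ← Real.exp_nat_mul,
    ← Real.exp_add, ← Real.exp_add]
  refine mul_le_mul_of_nonneg_left (Real.exp_le_exp.2 ?_) (by positivity)
  have := mul_sum_norm_le (c := c) w
  push_cast
  linarith

/-- `z · conj w` as a linear form in `z`. -/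
noncomputable def hermCLM (w : Fin n → ℂ) : (Fin n → ℂ) →L[ℂ] ℂ :=
  ∑ k, (starRingEnd ℂ) (w k) • ContinuousLinearMap.proj (R := ℂ) (φ := fun _ : Fin n => ℂ) k

theorem hermCLM_apply (w z : Fin n → ℂ) : hermCLM w z = herm z w := by
  simp [hermCLM, herm, mul_comm]

theorem norm_herm_le (z w : Fin n → ℂ) : ‖herm z w‖ ≤ ‖z‖ * ∑ k, ‖w k‖ := by
  rw [herm, Finset.mul_sum]
  refine norm_sum_le_of_le _ fun k _ => ?_
  rw [norm_mul, RCLike.norm_conj]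
  gcongr
  exact norm_le_pi_norm z k

theorem norm_hermCLM_le (w : Fin n → ℂ) : ‖hermCLM w‖ ≤ ∑ k, ‖w k‖ :=
  ContinuousLinearMap.opNorm_le_bound _ (by positivity) fun z => by
    rw [hermCLM_apply, mul_comm]
    exact norm_herm_le z w

theorem continuous_hermCLM : Continuous (hermCLM : (Fin n → ℂ) → _) := by
  unfold hermCLM
  fun_prop

theorem norm_exp_herm_le (z w : Fin n → ℂ) :
    ‖Complex.exp (herm z w)‖ ≤ Real.exp (‖z‖ * ∑ k, ‖w k‖) := by
  rw [Complex.norm_exp]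
  exact Real.exp_le_exp.2 ((Complex.re_le_norm _).trans (norm_herm_le z w))

theorem continuous_herm : Continuous fun p : (Fin n → ℂ) × (Fin n → ℂ) => herm p.1 p.2 := by
  unfold herm
  fun_prop

theorem differentiable_integral_exp_herm {g : (Fin n → ℂ) → ℂ} (hg : MemLp g 2 (gaussian n)) :
    Differentiable ℂ fun z => ∫ w, Complex.exp (herm z w) * g w ∂gaussian n := by
  intro z
  have hm (z : Fin n → ℂ) : Continuous fun w => Complex.exp (herm z w) :=
    Complex.continuous_exp.comp
      (continuous_herm.comp (continuous_const.prodMk continuous_id))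
  have hF (z : Fin n → ℂ) :
      AEStronglyMeasurable (fun w => Complex.exp (herm z w) * g w) (gaussian n) :=
    (hm z).aestronglyMeasurable.mul hg.1
  have hb : Integrable (fun w => Real.exp ((‖z‖ + 1 + 1) * ∑ k, ‖w k‖) * ‖g w‖) (gaussian n) :=
    (memLp_exp_mul_sum_norm (n := n) (‖z‖ + 1 + 1)).integrable_mul hg.norm
  refine (hasFDerivAt_integral_of_dominated_of_fderiv_le
    (F' := fun z w => (Complex.exp (herm z w) * g w) • hermCLM w)
    (Metric.ball_mem_nhds z one_pos) (Filter.Eventually.of_forall hF) (hb.mono' (hF z) ?_)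
    ((hF z).smul continuous_hermCLM.aestronglyMeasurable) ?_ hb ?_).differentiableAt
  · refine Filter.Eventually.of_forall fun w => ?_
    rw [norm_mul]
    gcongr
    refine (norm_exp_herm_le z w).trans (Real.exp_le_exp.2 ?_)
    gcongr
    linarith
  · refine Filter.Eventually.of_forall fun w x hx => ?_
    have hx' : ‖x‖ ≤ ‖z‖ + 1 := by
      have h1 : ‖x - z‖ < 1 := by simpa [dist_eq_norm] using hx
      have h2 := norm_le_norm_add_norm_sub' x z
      linarith
    rw [norm_smul, norm_mul, mul_right_comm, add_one_mul (‖z‖ + 1), Real.exp_add]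
    gcongr
    · exact (norm_exp_herm_le x w).trans (Real.exp_le_exp.2 (by gcongr))
    · refine (norm_hermCLM_le w).trans ?_
      have := Real.add_one_le_exp (∑ k, ‖w k‖)
      linarith
  · refine Filter.Eventually.of_forall fun w x _ => ?_
    have h1 : HasFDerivAt (fun x => herm x w) (hermCLM w) x := by
      simp_rw [← hermCLM_apply]
      exact (hermCLM w).hasFDerivAt
    have h2 := (h1.cexp).mul_const (g w)
    rwa [smul_smul, mul_comm] at h2

namespace Fock

theorem norm_toL2 (f : Fock n) : ‖toL2 n f‖ = ‖f‖ := rfl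

theorem isometry_toL2 : Isometry (toL2 n) :=
  AddMonoidHomClass.isometry_of_norm (toL2 n) norm_toL2

theorem inner_toL2_kernel (z : Fin n → ℂ) (g : Lp ℂ 2 (gaussian n)) :
    inner ℂ (toL2 n (kernel z)) g = ∫ w, Complex.exp (herm z w) * g w ∂gaussian n := by
  rw [L2.inner_def]
  refine integral_congr_ae ?_
  filter_upwards [MemLp.coeFn_toLp (kernel z).memLp] with w hw
  change inner ℂ ((MemLp.toLp (kernel z) (kernel z).memLp) w) (g w) = _
  rw [hw, RCLike.inner_apply, kernel_apply, ← Complex.exp_conj, conj_herm, mul_comm]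

theorem isClosed_range_toL2 : IsClosed (Set.range (toL2 n)) := by
  refine isClosed_of_closure_subset fun g hg => ?_
  obtain ⟨u, hu, hlim⟩ := mem_closure_iff_seq_limit.1 hg
  choose f hf using hu
  have hlim' : Filter.Tendsto (fun k => toL2 n (f k)) Filter.atTop (nhds g) := by
    simpa only [hf] using hlim
  have hG : Differentiable ℂ fun z => inner ℂ (toL2 n (kernel z)) g := by
    simp_rw [inner_toL2_kernel]
    exact differentiable_integral_exp_herm (Lp.memLp g)
  have hpt (z : Fin n → ℂ) : Filter.Tendsto (fun k => f k z) Filter.atTop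
      (nhds (inner ℂ (toL2 n (kernel z)) g)) := by
    have h : Filter.Tendsto (fun k => inner ℂ (toL2 n (kernel z)) (toL2 n (f k))) Filter.atTop
      (nhds (inner ℂ (toL2 n (kernel z)) g)) := tendsto_const_nhds.inner hlim'
    exact h.congr fun k => inner_kernel z (f k)
  obtain ⟨φ, hφ, hae⟩ := (tendstoInMeasure_of_tendsto_Lp hlim').exists_seq_tendsto_ae
  have heq : (g : (Fin n → ℂ) → ℂ) =ᵐ[gaussian n] fun z => inner ℂ (toL2 n (kernel z)) g := by
    have h1 := ae_all_iff.2 fun k => MemLp.coeFn_toLp (f k).memLp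
    filter_upwards [hae, h1] with z hz hz1
    refine tendsto_nhds_unique hz (((hpt z).comp hφ.tendsto_atTop).congr fun k => ?_)
    exact (hz1 (φ k)).symm
  let F : Fock n := ⟨_, hG, (memLp_congr_ae heq).1 (Lp.memLp g)⟩
  exact ⟨F, Lp.ext ((MemLp.coeFn_toLp F.memLp).trans heq.symm)⟩

instance completeSpace : CompleteSpace (Fock n) :=
  (completeSpace_iff_isComplete_range isometry_toL2.isUniformInducing).2
    isClosed_range_toL2.isComplete

end Fock

/-! ### The Toeplitz operator -/

/-- The measure `exp(-|w|²) dμ(w)`. -/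
noncomputable def weighted (μ : Measure (Fin n → ℂ)) : Measure (Fin n → ℂ) :=
  μ.withDensity fun w => ENNReal.ofReal (Real.exp (-sqNorm w))

theorem measurable_weight :
    Measurable fun w : Fin n → ℂ => ENNReal.ofReal (Real.exp (-sqNorm w)) := by
  have := measurable_sqNorm (n := n)
  fun_prop

variable {μ : Measure (Fin n → ℂ)}

theorem lintegral_sq_weighted (f : Fock n) :
    ∫⁻ w, ‖f w‖ₑ ^ 2 ∂weighted μ =
      ∫⁻ w, ENNReal.ofReal (‖f w‖ ^ 2 * Real.exp (-sqNorm w)) ∂μ := by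
  have := f.differentiable.continuous
  rw [weighted, lintegral_withDensity_eq_lintegral_mul _ measurable_weight (by fun_prop)]
  refine lintegral_congr fun w => ?_
  rw [Pi.mul_apply, mul_comm, ENNReal.ofReal_mul (by positivity),
    ENNReal.ofReal_pow (norm_nonneg _), ofReal_norm]

theorem eLpNorm_weighted_le {ω : ℝ} (hω : 0 < ω) (f : Fock n)
    (h : ∫⁻ w, ENNReal.ofReal (‖f w‖ ^ 2 * Real.exp (-sqNorm w)) ∂μ
      ≤ ENNReal.ofReal (ω * ‖f‖ ^ 2)) :
    eLpNorm f 2 (weighted μ) ≤ ENNReal.ofReal (√ω * ‖f‖) := by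
  rw [eLpNorm_eq_lintegral_rpow_enorm_toReal (by norm_num) (by norm_num)]
  simp only [ENNReal.toReal_ofNat, ENNReal.rpow_ofNat]
  rw [lintegral_sq_weighted, one_div, ENNReal.rpow_inv_le_iff (by norm_num)]
  refine h.trans (le_of_eq ?_)
  rw [ENNReal.rpow_ofNat, ← ENNReal.ofReal_pow (by positivity), mul_pow, Real.sq_sqrt hω.le]

theorem memLp_weighted (hμ : IsFockCarleson μ) (f : Fock n) : MemLp f 2 (weighted μ) := by
  obtain ⟨ω, hω, h⟩ := hμ
  exact ⟨f.differentiable.continuous.aestronglyMeasurable,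
    (eLpNorm_weighted_le hω f (h f)).trans_lt ENNReal.ofReal_lt_top⟩

/-- The bounded inclusion of the Fock space into `L²(ℂⁿ, exp(-|w|²) dμ)`. -/
noncomputable def embedding (hμ : IsFockCarleson μ) : Fock n →L[ℂ] Lp ℂ 2 (weighted μ) :=
  LinearMap.mkContinuousOfExistsBound
    { toFun := fun f => (memLp_weighted hμ f).toLp f
      map_add' := fun _ _ => rfl
      map_smul' := fun _ _ => rfl } (by
    have hμ' := hμ
    obtain ⟨ω, hω, h⟩ := hμ'
    refine ⟨√ω, fun f => ?_⟩
    change ‖(memLp_weighted hμ f).toLp f‖ ≤ _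
    rw [Lp.norm_toLp]
    exact ENNReal.toReal_le_of_le_ofReal (by positivity) (eLpNorm_weighted_le hω f (h f)))

theorem coeFn_embedding (hμ : IsFockCarleson μ) (f : Fock n) :
    (embedding hμ f : (Fin n → ℂ) → ℂ) =ᵐ[weighted μ] f :=
  MemLp.coeFn_toLp (memLp_weighted hμ f)

theorem integrable_toeplitzIntegrand (hμ : IsFockCarleson μ) (f : Fock n) (z : Fin n → ℂ) :
    Integrable (toeplitzIntegrand f z) μ := by
  have h := (memLp_weighted hμ (kernel z)).star.integrable_mul (memLp_weighted hμ f)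
  rw [weighted, integrable_withDensity_iff_integrable_smul' measurable_weight
    (Filter.Eventually.of_forall fun _ => ENNReal.ofReal_lt_top)] at h
  refine h.congr (Filter.Eventually.of_forall fun w => ?_)
  simp only [Pi.mul_apply, Pi.star_apply, kernel_apply, toeplitzIntegrand]
  rw [ENNReal.toReal_ofReal (by positivity), RCLike.star_def, ← Complex.exp_conj, conj_herm,
    Complex.real_smul, mul_comm]

theorem inner_embedding_kernel (hμ : IsFockCarleson μ) (f : Fock n) (z : Fin n → ℂ) :
    inner ℂ (embedding hμ (kernel z)) (embedding hμ f) = ∫ w, toeplitzIntegrand f z w ∂μ := by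
  rw [L2.inner_def]
  trans ∫ w, Complex.exp (herm z w) * f w ∂weighted μ
  · refine integral_congr_ae ?_
    filter_upwards [coeFn_embedding hμ (kernel z), coeFn_embedding hμ f] with w h1 h2
    rw [h1, h2, RCLike.inner_apply, kernel_apply, ← Complex.exp_conj, conj_herm, mul_comm]
  · rw [weighted, integral_withDensity_eq_integral_toReal_smul measurable_weight
      (Filter.Eventually.of_forall fun _ => ENNReal.ofReal_lt_top)]
    refine integral_congr_ae (Filter.Eventually.of_forall fun w => ?_)
    simp only [toeplitzIntegrand]
    rw [ENNReal.toReal_ofReal (by positivity), Complex.real_smul, mul_comm]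

/-- The Toeplitz operator `T_μ`. -/
noncomputable def toeplitz (hμ : IsFockCarleson μ) : Fock n →L[ℂ] Fock n :=
  ((Real.pi : ℂ) ^ n)⁻¹ • (ContinuousLinearMap.adjoint (embedding hμ) ∘L embedding hμ)

theorem isToeplitz_toeplitz (hμ : IsFockCarleson μ) : IsToeplitz μ (toeplitz hμ) := by
  refine fun f z => ⟨integrable_toeplitzIntegrand hμ f z, ?_⟩
  rw [← inner_kernel, toeplitz, smul_apply, inner_smul_right,
    ContinuousLinearMap.comp_apply, ContinuousLinearMap.adjoint_inner_right,
    inner_embedding_kernel]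

end FockCarleson

namespace FockCarleson

variable {n : ℕ} {μ ν : Measure (Fin n → ℂ)} {T : Fock n →L[ℂ] Fock n}

/-! ### The Berezin transform -/

theorem toeplitzIntegrand_coherent (z w : Fin n → ℂ) :
    Complex.exp (-((sqNorm z / 2 : ℝ) : ℂ)) * toeplitzIntegrand (coherent z) z w =
      (Real.exp (-sqNorm (z - w)) : ℂ) := by
  have h : herm z w + herm w z = ((2 * (herm z w).re : ℝ) : ℂ) := by
    rw [← conj_herm z w, Complex.add_conj]
  rw [toeplitzIntegrand, coherent_apply, Complex.ofReal_exp, Complex.ofReal_exp,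
    ← Complex.exp_add, ← Complex.exp_add, ← Complex.exp_add, sqNorm_sub]
  congr 1
  push_cast at h ⊢
  linear_combination h

theorem integrable_exp_neg_sqNorm_sub (hμ : IsFockCarleson μ) (z : Fin n → ℂ) :
    Integrable (fun w => Real.exp (-sqNorm (z - w))) μ := by
  have h := (integrable_toeplitzIntegrand hμ (coherent z) z).const_mul
    (Complex.exp (-((sqNorm z / 2 : ℝ) : ℂ)))
  simp_rw [toeplitzIntegrand_coherent] at h
  exact h.re

theorem berezin_eq_inner (hT : IsToeplitz μ T) (z : Fin n → ℂ) :
    (berezin μ z : ℂ) = inner ℂ (coherent z) (T (coherent z)) := by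
  rw [inner_coherent, (hT _ z).2, mul_left_comm, ← integral_const_mul]
  simp_rw [toeplitzIntegrand_coherent]
  rw [integral_complex_ofReal, berezin]
  push_cast
  rfl

theorem coherent_add (z a : Fin n → ℂ) :
    coherent (z + a) = Complex.exp ((herm a z).im * Complex.I) • weyl a (coherent z) := by
  refine DFunLike.ext _ _ fun w => ?_
  change _ = Complex.exp _ * weyl a (coherent z) w
  have hs : sqNorm (z + a) = sqNorm z + 2 * (herm a z).re + sqNorm a := by
    have := sqNorm_sub z (-a)
    rw [sub_neg_eq_add, herm_neg_right, sqNorm_neg, ← conj_herm a z] at this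
    simpa using this
  have hre := Complex.re_add_im (herm a z)
  rw [weyl_apply, coherent_apply, coherent_apply, ← Complex.exp_add, ← Complex.exp_add, hs,
    herm_add_right, herm_sub_left]
  congr 1
  push_cast
  linear_combination -hre

theorem berezin_add_of_commute (hT : IsToeplitz μ T) (a : Fin n → ℂ)
    (h : (weyl a).toContinuousLinearMap ∘L T = T ∘L (weyl a).toContinuousLinearMap)
    (z : Fin n → ℂ) : berezin μ (z + a) = berezin μ z := by
  have hc : T (weyl a (coherent z)) = weyl a (T (coherent z)) :=
    (DFunLike.congr_fun h (coherent z)).symm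
  rw [← Complex.ofReal_inj, berezin_eq_inner hT, berezin_eq_inner hT, coherent_add, map_smul,
    inner_smul_left, inner_smul_right, hc, LinearIsometry.inner_map_map, ← mul_assoc,
    Complex.conj_mul', Complex.norm_exp_ofReal_mul_I]
  simp

theorem exists_berezin_eq_of_add_imag
    (h : ∀ (z : Fin n → ℂ) (y : Fin n → ℝ), berezin μ (z + imag y) = berezin μ z) :
    ∃ b : (Fin n → ℝ) → ℝ, ∀ z, berezin μ z = b (rePart z) := by
  refine ⟨fun x => berezin μ fun k => (x k : ℂ), fun z => ?_⟩
  beta_reduce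
  rw [← h (fun k => (rePart z k : ℂ)) (imPart z)]
  congr 1
  ext k
  simp [rePart, imPart, imag, mul_comm Complex.I]

/-! ### Injectivity of the Berezin transform -/

theorem exists_eq_re_herm (L : StrongDual ℝ (Fin n → ℂ)) :
    ∃ t : Fin n → ℂ, ∀ w, L w = (herm t w).re := by
  refine ⟨fun k => ⟨L (Pi.single k 1), L (Pi.single k Complex.I)⟩, fun w => ?_⟩
  have hw : w = ∑ k, ((w k).re • (Pi.single k 1 : Fin n → ℂ) +
      (w k).im • (Pi.single k Complex.I : Fin n → ℂ)) := by
    ext j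
    simp [Finset.sum_apply, Pi.single_apply, Finset.sum_add_distrib]
  conv_lhs => rw [hw]
  simp [herm, mul_comm]

theorem re_herm_real_smul (s : ℝ) (t w : Fin n → ℂ) :
    (herm (s • t) w).re = s * (herm t w).re := by
  simp [herm, Finset.mul_sum, mul_assoc]

theorem exp_mul_exp_neg_sqNorm (s : ℝ) (t w : Fin n → ℂ) :
    Real.exp (-sqNorm w) * Real.exp (s * (herm t w).re) =
      Real.exp (sqNorm ((s / 2) • t)) * Real.exp (-sqNorm ((s / 2) • t - w)) := by
  rw [sqNorm_sub, re_herm_real_smul, ← Real.exp_add, ← Real.exp_add]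
  congr 1
  ring

theorem integrable_exp_weighted
    (h : ∀ z, Integrable (fun w => Real.exp (-sqNorm (z - w))) μ) (t : Fin n → ℂ) (s : ℝ) :
    Integrable (fun w => Real.exp (s * (herm t w).re)) (weighted μ) := by
  rw [weighted, integrable_withDensity_iff_integrable_smul' measurable_weight
    (Filter.Eventually.of_forall fun _ => ENNReal.ofReal_lt_top)]
  refine ((h ((s / 2) • t)).const_mul (Real.exp (sqNorm ((s / 2) • t)))).congr
    (Filter.Eventually.of_forall fun w => ?_)
  simp only [smul_eq_mul]
  rw [ENNReal.toReal_ofReal (by positivity), exp_mul_exp_neg_sqNorm]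

theorem mgf_weighted (t : Fin n → ℂ) (s : ℝ) :
    ProbabilityTheory.mgf (fun w => (herm t w).re) (weighted μ) s =
      Real.exp (sqNorm ((s / 2) • t)) * (Real.pi ^ n * berezin μ ((s / 2) • t)) := by
  rw [ProbabilityTheory.mgf, weighted, integral_withDensity_eq_integral_toReal_smul
    measurable_weight (Filter.Eventually.of_forall fun _ => ENNReal.ofReal_lt_top), berezin,
    mul_inv_cancel_left₀ (by positivity), ← integral_const_mul]
  refine integral_congr_ae (Filter.Eventually.of_forall fun w => ?_)
  simp only [smul_eq_mul]
  rw [ENNReal.toReal_ofReal (by positivity), exp_mul_exp_neg_sqNorm]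

theorem isFiniteMeasure_weighted
    (h : ∀ z, Integrable (fun w => Real.exp (-sqNorm (z - w))) μ) :
    IsFiniteMeasure (weighted μ) := by
  have := integrable_exp_weighted h 0 0
  simpa [integrable_const_iff] using this

theorem weighted_injective (h : weighted μ = weighted ν) : μ = ν := by
  have key (μ : Measure (Fin n → ℂ)) : (weighted μ).withDensity
      (fun w => ENNReal.ofReal (Real.exp (-sqNorm w)))⁻¹ = μ :=
    withDensity_inv_same measurable_weight
      (Filter.Eventually.of_forall fun w => by simp [Real.exp_pos])
      (Filter.Eventually.of_forall fun w => ENNReal.ofReal_ne_top)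
  rw [← key μ, ← key ν, h]

theorem eq_of_berezin_eq (hμ : ∀ z, Integrable (fun w => Real.exp (-sqNorm (z - w))) μ)
    (hν : ∀ z, Integrable (fun w => Real.exp (-sqNorm (z - w))) ν)
    (h : ∀ z, berezin μ z = berezin ν z) : μ = ν := by
  have := isFiniteMeasure_weighted hμ
  have := isFiniteMeasure_weighted hν
  refine weighted_injective (Measure.ext_of_charFunDual (funext fun L => ?_))
  obtain ⟨t, ht⟩ := exists_eq_re_herm L
  have hmgf : ProbabilityTheory.mgf (fun w => (herm t w).re) (weighted μ) =
      ProbabilityTheory.mgf (fun w => (herm t w).re) (weighted ν) := by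
    ext s
    rw [mgf_weighted, mgf_weighted, h]
  have hzero : weighted μ = 0 ↔ weighted ν = 0 := by
    have h0 := congrFun hmgf 0
    rw [ProbabilityTheory.mgf_zero', ProbabilityTheory.mgf_zero'] at h0
    rw [← Measure.measure_univ_eq_zero, ← Measure.measure_univ_eq_zero,
      ← measureReal_eq_zero_iff, ← measureReal_eq_zero_iff, h0]
  have hset : ProbabilityTheory.integrableExpSet (fun w => (herm t w).re) (weighted μ) =
      Set.univ :=
    Set.eq_univ_of_forall fun s => integrable_exp_weighted hμ t s
  have heq := ProbabilityTheory.eqOn_complexMGF_of_mgf' hmgf hzero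
    (x := Complex.I) (by simp [hset])
  simpa [charFunDual_apply, ProbabilityTheory.complexMGF, ht, mul_comm] using heq

theorem map_sub_eq_of_berezin_add (hμ : IsFockCarleson μ) (a : Fin n → ℂ)
    (h : ∀ z, berezin μ (z + a) = berezin μ z) : μ.map (fun z => z - a) = μ := by
  have hm : Measurable fun z : Fin n → ℂ => z - a := by fun_prop
  have hs := measurable_sqNorm (n := n)
  have hg (z : Fin n → ℂ) : Measurable fun w => Real.exp (-sqNorm (z - w)) := by fun_prop
  have hsub (z w : Fin n → ℂ) : z - (w - a) = z + a - w := by abel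
  refine eq_of_berezin_eq (fun z => ?_) (integrable_exp_neg_sqNorm_sub hμ) fun z => ?_
  · rw [integrable_map_measure (hg z).aestronglyMeasurable hm.aemeasurable]
    simpa only [Function.comp_def, hsub] using integrable_exp_neg_sqNorm_sub hμ (z + a)
  · rw [← h z, berezin, berezin, integral_map hm.aemeasurable (hg z).aestronglyMeasurable]
    simp only [hsub]

end FockCarleson

namespace FockCarleson

variable {n : ℕ} {μ : Measure (Fin n → ℂ)} {T : Fock n →L[ℂ] Fock n}

/-! ### Invariance under imaginary translations -/

theorem image_add_right_eq_preimage (a : Fin n → ℂ) (X : Set (Fin n → ℂ)) :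
    (fun z => z + a) '' X = (fun z => z - a) ⁻¹' X := by
  ext z
  simp [sub_eq_add_neg]

theorem measure_image_add_of_map_sub {a : Fin n → ℂ} (h : μ.map (fun z => z - a) = μ)
    {X : Set (Fin n → ℂ)} (hX : MeasurableSet X) : μ ((fun z => z + a) '' X) = μ X := by
  conv_rhs => rw [← h]
  rw [Measure.map_apply (by fun_prop) hX, image_add_right_eq_preimage]

theorem map_sub_of_measure_image_add {a : Fin n → ℂ}
    (h : ∀ X, MeasurableSet X → μ ((fun z => z + a) '' X) = μ X) :
    μ.map (fun z => z - a) = μ := by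
  refine Measure.ext fun X hX => ?_
  rw [Measure.map_apply (by fun_prop) hX, ← image_add_right_eq_preimage, h X hX]

theorem measurable_rePart : Measurable (rePart : (Fin n → ℂ) → _) := by
  unfold rePart
  fun_prop

theorem measurable_imPart : Measurable (imPart : (Fin n → ℂ) → _) := by
  unfold imPart
  fun_prop

theorem measurable_ofReIm : Measurable (ofReIm : (Fin n → ℝ) × (Fin n → ℝ) → _) := by
  unfold ofReIm
  fun_prop

theorem ofReIm_rePart_imPart (z : Fin n → ℂ) : ofReIm (rePart z, imPart z) = z := by
  ext k
  simp [ofReIm, rePart, imPart, mul_comm Complex.I]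

@[simp] theorem rePart_sub_imag (z : Fin n → ℂ) (h : Fin n → ℝ) :
    rePart (z - imag h) = rePart z := by
  ext k
  simp [rePart, imag]

@[simp] theorem imPart_sub_imag (z : Fin n → ℂ) (h : Fin n → ℝ) :
    imPart (z - imag h) = imPart z - h := by
  ext k
  simp [imPart, imag]

theorem ofReIm_sub_imag (p : (Fin n → ℝ) × (Fin n → ℝ)) (h : Fin n → ℝ) :
    ofReIm p - imag h = ofReIm (p.1, p.2 - h) := by
  ext k
  simp [ofReIm, imag, mul_sub]
  ring

theorem measurableSet_reImProd {Y Z : Set (Fin n → ℝ)} (hY : MeasurableSet Y)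
    (hZ : MeasurableSet Z) : MeasurableSet (reImProd Y Z) :=
  (measurable_rePart hY).inter (measurable_imPart hZ)

theorem reImProd_image_add (Y Z : Set (Fin n → ℝ)) (h : Fin n → ℝ) :
    reImProd Y ((fun y => y + h) '' Z) = (fun z => z + imag h) '' reImProd Y Z := by
  rw [image_add_right_eq_preimage]
  ext z
  change rePart z ∈ Y ∧ imPart z ∈ _ ↔ rePart (z - imag h) ∈ Y ∧ imPart (z - imag h) ∈ Z
  rw [rePart_sub_imag, imPart_sub_imag]
  simp [sub_eq_add_neg]

theorem weyl_toeplitz_of_map_sub (hT : IsToeplitz μ T) {h : Fin n → ℝ}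
    (hinv : μ.map (fun z => z - imag h) = μ) :
    (weyl (imag h)).toContinuousLinearMap ∘L T =
      T ∘L (weyl (imag h)).toContinuousLinearMap := by
  refine ContinuousLinearMap.ext fun f => DFunLike.ext _ _ fun z => ?_
  change weyl (imag h) (T f) z = T (weyl (imag h) f) z
  set a := imag h
  have hmp : MeasurePreserving (MeasurableEquiv.subRight a) μ μ := ⟨by fun_prop, hinv⟩
  rw [weyl_apply, (hT f _).2, (hT _ z).2, mul_left_comm, ← integral_const_mul]
  congr 1
  rw [← hmp.integral_comp']
  refine integral_congr_ae (Filter.Eventually.of_forall fun w => ?_)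
  change _ * toeplitzIntegrand f (z - a) (w - a) = _
  simp only [toeplitzIntegrand, weyl_apply]
  rw [sqNorm_sub w a, Complex.ofReal_exp, Complex.ofReal_exp]
  have key : herm z a - ((sqNorm a / 2 : ℝ) : ℂ) + herm (z - a) (w - a) +
      ((-(sqNorm w - 2 * (herm w a).re + sqNorm a) : ℝ) : ℂ) =
      herm w a - ((sqNorm a / 2 : ℝ) : ℂ) + herm z w + ((-sqNorm w : ℝ) : ℂ) := by
    have h1 : herm (z - a) (w - a) = herm z w - herm z a - herm a w + (sqNorm a : ℂ) := by
      rw [sub_eq_add_neg w, herm_add_right, herm_neg_right, herm_sub_left, herm_sub_left,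
        herm_self]
      ring
    have h2 : herm w a + herm a w = ((2 * (herm w a).re : ℝ) : ℂ) := by
      rw [← conj_herm w a, Complex.add_conj]
    rw [h1]
    push_cast at h2 ⊢
    linear_combination -h2
  have key' := congrArg Complex.exp key
  rw [Complex.exp_add, Complex.exp_add, Complex.exp_add, Complex.exp_add] at key'
  linear_combination f (w - a) * key'

theorem map_sub_of_isHorizontalMeasure (hμ : IsHorizontalMeasure μ) (h : Fin n → ℝ) :
    μ.map (fun z => z - imag h) = μ := by
  obtain ⟨ϱ, hϱ, rfl⟩ := hμ
  have hmp : MeasurePreserving (fun p : (Fin n → ℝ) × (Fin n → ℝ) => (p.1, p.2 - h))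
      (ϱ.prod volume) (ϱ.prod volume) :=
    (MeasurePreserving.id ϱ).prod (measurePreserving_sub_right volume h)
  conv_rhs => rw [← hmp.map_eq]
  rw [Measure.map_map (by fun_prop) measurable_ofReIm,
    Measure.map_map measurable_ofReIm hmp.measurable]
  exact congrArg (fun g => Measure.map g _) (funext fun p => ofReIm_sub_imag p h)

/-! ### Disintegration of horizontal measures -/

theorem sqNorm_le (z : Fin n → ℂ) : sqNorm z ≤ n * (‖rePart z‖ ^ 2 + ‖imPart z‖ ^ 2) := by
  have h (k : Fin n) : ‖z k‖ ^ 2 ≤ ‖rePart z‖ ^ 2 + ‖imPart z‖ ^ 2 := by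
    rw [Complex.sq_norm, Complex.normSq_apply, ← sq, ← sq, ← sq_abs (z k).re, ← sq_abs (z k).im]
    gcongr
    · exact norm_le_pi_norm (rePart z) k
    · exact norm_le_pi_norm (imPart z) k
  simpa [sqNorm, mul_add] using Finset.sum_le_card_nsmul Finset.univ _ _ fun k _ => h k

theorem measure_reImProd_lt_top (hμ : IsFockCarleson μ) {Y Z : Set (Fin n → ℝ)}
    (hY : Bornology.IsBounded Y) (hZ : Bornology.IsBounded Z) : μ (reImProd Y Z) < ∞ := by
  obtain ⟨R, hR⟩ := hY.exists_norm_le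
  obtain ⟨S, hS⟩ := hZ.exists_norm_le
  refine lt_of_le_of_lt (measure_mono fun z hz => ?_)
    ((integrable_exp_neg_sqNorm_sub hμ 0).measure_ge_lt_top
      (Real.exp_pos (-(n * (R ^ 2 + S ^ 2)))))
  have h1 := hR _ hz.1
  have h2 := hS _ hz.2
  simp only [Set.mem_ofPred_eq, zero_sub, sqNorm_neg, Real.exp_le_exp, neg_le_neg_iff]
  refine (sqNorm_le z).trans ?_
  gcongr

/-- The measure `Z ↦ μ(Y × Z)`. -/
noncomputable def imSlice (μ : Measure (Fin n → ℂ)) (Y : Set (Fin n → ℝ)) :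
    Measure (Fin n → ℝ) :=
  (μ.restrict (rePart ⁻¹' Y)).map imPart

/-- The measure `Y ↦ μ(Y × Z)`. -/
noncomputable def reSlice (μ : Measure (Fin n → ℂ)) (Z : Set (Fin n → ℝ)) :
    Measure (Fin n → ℝ) :=
  (μ.restrict (imPart ⁻¹' Z)).map rePart

theorem imSlice_apply (Y : Set (Fin n → ℝ)) {Z : Set (Fin n → ℝ)}
    (hZ : MeasurableSet Z) : imSlice μ Y Z = μ (reImProd Y Z) := by
  rw [imSlice, Measure.map_apply measurable_imPart hZ,
    Measure.restrict_apply (measurable_imPart hZ), Set.inter_comm]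
  rfl

theorem reSlice_apply {Y : Set (Fin n → ℝ)} (hY : MeasurableSet Y) (Z : Set (Fin n → ℝ)) :
    reSlice μ Z Y = μ (reImProd Y Z) := by
  rw [reSlice, Measure.map_apply measurable_rePart hY,
    Measure.restrict_apply (measurable_rePart hY)]
  rfl

/-- The unit cube of `ℝⁿ`. -/
def unitCube (n : ℕ) : Set (Fin n → ℝ) := Set.Icc 0 1

theorem measurableSet_unitCube : MeasurableSet (unitCube n) := measurableSet_Icc

theorem volume_unitCube : volume (unitCube n) = 1 := by
  simp [unitCube, Real.volume_Icc_pi]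

theorem measure_reImProd_of_isBounded (hμ : IsFockCarleson μ)
    (hinv : ∀ Y Z : Set (Fin n → ℝ), MeasurableSet Y → MeasurableSet Z → ∀ h : Fin n → ℝ,
      μ (reImProd Y ((fun y => y + h) '' Z)) = μ (reImProd Y Z))
    {Y Z : Set (Fin n → ℝ)} (hY : MeasurableSet Y) (hYb : Bornology.IsBounded Y)
    (hZ : MeasurableSet Z) :
    μ (reImProd Y Z) = μ (reImProd Y (unitCube n)) * volume Z := by
  have hfin : IsFiniteMeasureOnCompacts (imSlice μ Y) := ⟨fun K hK => by
    rw [imSlice_apply Y hK.measurableSet]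
    exact measure_reImProd_lt_top hμ hYb hK.isBounded⟩
  have hleft : (imSlice μ Y).IsAddLeftInvariant := ⟨fun g => by
    refine Measure.ext fun Z hZ => ?_
    rw [Measure.map_apply (by fun_prop) hZ, imSlice_apply Y hZ,
      imSlice_apply Y (hZ.preimage (by fun_prop)), ← hinv Y Z hY hZ (-g)]
    congr 2
    ext y
    simp [add_comm]⟩
  have hsmul := Measure.isAddLeftInvariant_eq_smul (imSlice μ Y) volume
  rw [← imSlice_apply Y hZ, ← imSlice_apply Y measurableSet_unitCube, hsmul]
  simp [volume_unitCube]

theorem isHorizontalMeasure_of_measure_reImProd (hμ : IsFockCarleson μ)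
    (hinv : ∀ Y Z : Set (Fin n → ℝ), MeasurableSet Y → MeasurableSet Z → ∀ h : Fin n → ℝ,
      μ (reImProd Y ((fun y => y + h) '' Z)) = μ (reImProd Y Z)) :
    IsHorizontalMeasure μ := by
  have hfin : IsFiniteMeasureOnCompacts (reSlice μ (unitCube n)) := ⟨fun K hK => by
    rw [reSlice_apply hK.measurableSet]
    exact measure_reImProd_lt_top hμ hK.isBounded (Metric.isBounded_Icc 0 1)⟩
  have hloc : IsLocallyFiniteMeasure (reSlice μ (unitCube n)) :=
    isLocallyFiniteMeasure_of_isFiniteMeasureOnCompacts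
  refine ⟨reSlice μ (unitCube n), inferInstance, ?_⟩
  have hm : Measurable fun z : Fin n → ℂ => (rePart z, imPart z) :=
    measurable_rePart.prodMk measurable_imPart
  have hprod : (reSlice μ (unitCube n)).prod volume =
      μ.map fun z => (rePart z, imPart z) := by
    refine Measure.prod_eq fun Y Z hY hZ => ?_
    rw [Measure.map_apply hm (hY.prod hZ)]
    change μ (reImProd Y Z) = _
    have heq : reSlice μ Z = volume Z • reSlice μ (unitCube n) := by
      have hU : ⋃ k : ℕ, Metric.closedBall (0 : Fin n → ℝ) k = Set.univ :=
        Metric.iUnion_closedBall_nat 0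
      refine (Measure.ext_iff_of_iUnion_eq_univ hU).2 fun k => Measure.ext fun s hs => ?_
      have hsk := hs.inter (Metric.isClosed_closedBall (x := (0 : Fin n → ℝ)) (ε := k)).measurableSet
      rw [Measure.restrict_apply hs, Measure.restrict_apply hs, Measure.smul_apply,
        reSlice_apply hsk, reSlice_apply hsk, smul_eq_mul, mul_comm]
      exact measure_reImProd_of_isBounded hμ hinv hsk
        (Metric.isBounded_closedBall.subset Set.inter_subset_right) hZ
    rw [← reSlice_apply hY, heq, Measure.smul_apply, smul_eq_mul, mul_comm]
  rw [hprod, Measure.map_map measurable_ofReIm hm]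
  simp [Function.comp_def, ofReIm_rePart_imPart]

end FockCarleson

theorem theorem4p3 (n : ℕ) (μ : MeasureTheory.Measure (Fin n → ℂ))
    (hμ : FockCarleson.IsFockCarleson μ) :
    ∃ T : FockCarleson.Fock n →L[ℂ] FockCarleson.Fock n, FockCarleson.IsToeplitz μ T ∧
      List.TFAE [
        FockCarleson.IsHorizontalOp T,
        ∃ b : (Fin n → ℝ) → ℝ, ∀ z : Fin n → ℂ,
          FockCarleson.berezin μ z = b (FockCarleson.rePart z),
        ∀ X : Set (Fin n → ℂ), MeasurableSet X → ∀ h : Fin n → ℝ,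
          μ ((fun z => z + FockCarleson.imag h) '' X) = μ X,
        ∀ Y Z : Set (Fin n → ℝ), MeasurableSet Y → MeasurableSet Z → ∀ h : Fin n → ℝ,
          μ (FockCarleson.reImProd Y ((fun y => y + h) '' Z)) = μ (FockCarleson.reImProd Y Z),
        FockCarleson.IsHorizontalMeasure μ] := by
  have hT := FockCarleson.isToeplitz_toeplitz hμ
  refine ⟨FockCarleson.toeplitz hμ, hT, ?_⟩
  tfae_have 1 → 2 := fun h => FockCarleson.exists_berezin_eq_of_add_imag fun z y =>
    FockCarleson.berezin_add_of_commute hT _ (h y) z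
  tfae_have 2 → 3 := by
    rintro ⟨b, hb⟩ X hX h
    refine FockCarleson.measure_image_add_of_map_sub
      (FockCarleson.map_sub_eq_of_berezin_add hμ _ fun z => ?_) hX
    rw [hb, hb]
    congr 1
    ext k
    simp [FockCarleson.rePart, FockCarleson.imag]
  tfae_have 3 → 4 := by
    intro h3 Y Z hY hZ h
    rw [FockCarleson.reImProd_image_add]
    exact h3 _ (FockCarleson.measurableSet_reImProd hY hZ) h
  tfae_have 4 → 5 := FockCarleson.isHorizontalMeasure_of_measure_reImProd hμ
  tfae_have 5 → 3 := fun h5 X hX h => FockCarleson.measure_image_add_of_map_sub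
    (FockCarleson.map_sub_of_isHorizontalMeasure h5 h) hX
  tfae_have 3 → 1 := fun h3 h => FockCarleson.weyl_toeplitz_of_map_sub hT
    (FockCarleson.map_sub_of_measure_image_add fun X hX => h3 X hX h)
  tfae_finish
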